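/- Let $(M,g)$ be a smooth $n$-dimensional Riemannian manifold, let $U\subseteq M$ be open, and let $e_1,\dots,e_n$ be a smooth orthonormal frame of $TM$ over $U$. Let $c^k_{ij}:U\to\mathbb R$ be its structure functions, defined by $[e_i,e_j]=\sum_{k=1}^n c^k_{ij}\,e_k$ on $U$. Let $S$ be the scalar curvature of $g$, that is, $S=\sum_{i,j}g(R(b_i,b_j)b_j,b_i)$ at each point for any orthonormal basis $b_1,\dots,b_n$ of the tangent space there, where $R(X,Y)Z=\nabla_X\nabla_YZ-\nabla_Y\nabla_XZ-\nabla_{[X,Y]}Z$ and $\nabla$ is the Levi-Civita connection of $g$. Then at every point of $U$ $$S=2\sum_{j,k=1}^n e_k\bigl(c^j_{kj}\bigr)-\sum_{i,j,k=1}^n\Bigl[c^k_{ik}c^j_{ij}+\tfrac12\,c^i_{kj}c^k_{ij}+\tfrac14\bigl(c^i_{kj}\bigr)^2\Bigr],$$ where $e_k(f)$ denotes the derivative of the function $f$ in the direction $e_k$. -/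

import Mathlib

open Bundle Manifold VectorField
open scoped ContDiff

set_option linter.unusedSectionVars false

noncomputable section

namespace RiemannianScalar

variable {E : Type*} [NormedAddCommGroup E] [NormedSpace ℝ E] [FiniteDimensional ℝ E]
  {H : Type*} [TopologicalSpace H] {I : ModelWithCorners ℝ E H}
  {M : Type*} [TopologicalSpace M] [ChartedSpace H M] [IsManifold I ∞ M]
  [RiemannianBundle (fun x : M => TangentSpace I x)]
  [IsContMDiffRiemannianBundle I ∞ E (fun x : M => TangentSpace I x)]

instance instFiniteDimensionalTangentSpace (x : M) : FiniteDimensional ℝ (TangentSpace I x) :=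
  inferInstanceAs (FiniteDimensional ℝ E)

/-! ### The Levi-Civita connection -/

/-- A connection on the tangent bundle is a Levi-Civita connection of the given Riemannian metric
if it is compatible with the metric and torsion-free. -/
def IsLeviCivita (cov : CovariantDerivative I E (fun x : M => TangentSpace I x)) : Prop :=
  CovariantDerivative.IsMetricCompatible (V := fun x : M => TangentSpace I x) cov ∧
    CovariantDerivative.torsion cov = 0

/-- The Koszul expression: half of
`X⟨Y,Z⟩ + Y⟨X,Z⟩ - Z⟨X,Y⟩ + ⟨[X,Y],Z⟩ - ⟨[X,Z],Y⟩ - ⟨[Y,Z],X⟩`. -/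
def koszul (Y X Z : Π x : M, TangentSpace I x) (x : M) : ℝ :=
  (1 / 2 : ℝ) *
    (mvfderiv I (fun y => (inner ℝ (Y y) (Z y) : ℝ)) x (X x)
      + mvfderiv I (fun y => (inner ℝ (X y) (Z y) : ℝ)) x (Y x)
      - mvfderiv I (fun y => (inner ℝ (X y) (Y y) : ℝ)) x (Z x)
      + inner ℝ (mlieBracket I X Y x) (Z x)
      - inner ℝ (mlieBracket I X Z x) (Y x)
      - inner ℝ (mlieBracket I Y Z x) (X x))

theorem mdifferentiableAt_inner {x : M} {Y Z : Π x : M, TangentSpace I x}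
    (hY : MDiffAt (T% Y) x) (hZ : MDiffAt (T% Z) x) :
    MDiffAt (fun y => (inner ℝ (Y y) (Z y) : ℝ)) x :=
  MDifferentiableAt.inner_bundle (IB := I) (IM := I) (M := M) (B := M) (b := fun x => x) (F := E)
    (E := fun x : M => TangentSpace I x) hY hZ

theorem mvfderiv_inner_comm (Y Z : Π x : M, TangentSpace I x) :
    mvfderiv I (fun y => (inner ℝ (Y y) (Z y) : ℝ)) =
      mvfderiv I (fun y => (inner ℝ (Z y) (Y y) : ℝ)) := by
  congr 1
  funext y
  exact real_inner_comm _ _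

theorem mvfderiv_inner_smul {x : M} {Y Z : Π x : M, TangentSpace I x} {f : M → ℝ}
    (hf : MDiffAt f x) (hY : MDiffAt (T% Y) x) (hZ : MDiffAt (T% Z) x) (v : TangentSpace I x) :
    mvfderiv I (fun y => (inner ℝ ((f • Y) y) (Z y) : ℝ)) x v =
      f x * mvfderiv I (fun y => (inner ℝ (Y y) (Z y) : ℝ)) x v
        + inner ℝ (Y x) (Z x) * mvfderiv I f x v := by
  have h := mvfderiv_fun_mul hf (mdifferentiableAt_inner hY hZ)
  have e : (fun y => (inner ℝ ((f • Y) y) (Z y) : ℝ)) = fun y => f y * inner ℝ (Y y) (Z y) := by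
    funext y
    exact real_inner_smul_left _ _ _
  rw [e, h]
  simp

theorem mvfderiv_inner_add {x : M} {Y Y' Z : Π x : M, TangentSpace I x}
    (hY : MDiffAt (T% Y) x) (hY' : MDiffAt (T% Y') x) (hZ : MDiffAt (T% Z) x)
    (v : TangentSpace I x) :
    mvfderiv I (fun y => (inner ℝ ((Y + Y') y) (Z y) : ℝ)) x v =
      mvfderiv I (fun y => (inner ℝ (Y y) (Z y) : ℝ)) x v
        + mvfderiv I (fun y => (inner ℝ (Y' y) (Z y) : ℝ)) x v := by
  have h := mvfderiv_fun_add (mdifferentiableAt_inner hY hZ) (mdifferentiableAt_inner hY' hZ)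
  have e : (fun y => (inner ℝ ((Y + Y') y) (Z y) : ℝ)) =
      fun y => inner ℝ (Y y) (Z y) + inner ℝ (Y' y) (Z y) := by
    funext y
    exact inner_add_left _ _ _
  rw [e, h]
  simp

theorem koszul_tensorial_left {x : M} {Y Z : Π x : M, TangentSpace I x}
    (hY : MDiffAt (T% Y) x) (hZ : MDiffAt (T% Z) x) :
    TensorialAt I E (fun X => koszul Y X Z x) x where
  smul {f X} hf hX := by
    simp only [koszul, mvfderiv_inner_smul hf hX hY, mvfderiv_inner_smul hf hX hZ]
    simp only [mlieBracket_smul_left hf hX, Pi.smul_apply', map_smul, inner_add_left, real_inner_smul_left,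
      real_inner_smul_right, smul_eq_mul]
    ring
  add {X X'} hX hX' := by
    simp only [koszul, mvfderiv_inner_add hX hX' hY, mvfderiv_inner_add hX hX' hZ]
    simp only [mlieBracket_add_left hX hX', Pi.add_apply, map_add, inner_add_left, inner_add_right]
    ring

theorem koszul_tensorial_right {x : M} {Y X : Π x : M, TangentSpace I x}
    (hY : MDiffAt (T% Y) x) (hX : MDiffAt (T% X) x) :
    TensorialAt I E (fun Z => koszul Y X Z x) x where
  smul {f Z} hf hZ := by
    simp only [koszul, mvfderiv_inner_comm _ (f • Z), mvfderiv_inner_smul hf hZ hY,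
      mvfderiv_inner_smul hf hZ hX, mvfderiv_inner_comm Z Y, mvfderiv_inner_comm Z X]
    simp only [mlieBracket_smul_right hf hZ, Pi.smul_apply', map_smul, inner_add_left,
      real_inner_smul_left, real_inner_smul_right, smul_eq_mul]
    rw [real_inner_comm (Y x) (Z x), real_inner_comm (X x) (Z x)]
    ring
  add {Z Z'} hZ hZ' := by
    simp only [koszul, mvfderiv_inner_comm _ (Z + Z'), mvfderiv_inner_add hZ hZ' hY,
      mvfderiv_inner_add hZ hZ' hX, mvfderiv_inner_comm Z Y, mvfderiv_inner_comm Z' Y,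
      mvfderiv_inner_comm Z X, mvfderiv_inner_comm Z' X]
    simp only [mlieBracket_add_right hZ hZ', Pi.add_apply, map_add, inner_add_left, inner_add_right]
    ring

theorem koszul_smul {x : M} {Y X Z : Π x : M, TangentSpace I x} {f : M → ℝ} (hf : MDiffAt f x)
    (hY : MDiffAt (T% Y) x) (hX : MDiffAt (T% X) x) (hZ : MDiffAt (T% Z) x) :
    koszul (f • Y) X Z x = f x * koszul Y X Z x + mvfderiv I f x (X x) * inner ℝ (Y x) (Z x) := by
  simp only [koszul, mvfderiv_inner_comm X (f • Y), mvfderiv_inner_smul hf hY hZ,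
    mvfderiv_inner_smul hf hY hX, mvfderiv_inner_comm Y X]
  simp only [mlieBracket_smul_left hf hY, mlieBracket_smul_right hf hY, Pi.smul_apply', map_smul, inner_add_left, real_inner_smul_left,
    real_inner_smul_right, smul_eq_mul]
  rw [real_inner_comm (X x) (Y x)]
  ring

theorem koszul_add {x : M} {Y Y' X Z : Π x : M, TangentSpace I x}
    (hY : MDiffAt (T% Y) x) (hY' : MDiffAt (T% Y') x) (hX : MDiffAt (T% X) x)
    (hZ : MDiffAt (T% Z) x) :
    koszul (Y + Y') X Z x = koszul Y X Z x + koszul Y' X Z x := by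
  simp only [koszul, mvfderiv_inner_comm X (Y + Y'), mvfderiv_inner_add hY hY' hZ,
    mvfderiv_inner_add hY hY' hX, mvfderiv_inner_comm Y X, mvfderiv_inner_comm Y' X]
  simp only [mlieBracket_add_left hY hY', mlieBracket_add_right hY hY', Pi.add_apply, map_add,
    inner_add_left, inner_add_right]
  ring

open scoped Classical in
/-- The vector-valued form `X ↦ ∇_X Y` at `x` determined by the Koszul formula. -/
def koszulConnection (Y : Π x : M, TangentSpace I x) (x : M) :
    TangentSpace I x →L[ℝ] TangentSpace I x :=
  if hY : MDiffAt (T% Y) x then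
    ∑ i, ((TensorialAt.mkHom₂ (fun X Z => koszul Y X Z x) x
        (fun _ hZ => koszul_tensorial_left hY hZ)
        (fun _ hX => koszul_tensorial_right hY hX)).flip
          (stdOrthonormalBasis ℝ (TangentSpace I x) i)).smulRight
        (stdOrthonormalBasis ℝ (TangentSpace I x) i)
  else 0

theorem inner_koszulConnection {x : M} {Y X Z : Π x : M, TangentSpace I x}
    (hY : MDiffAt (T% Y) x) (hX : MDiffAt (T% X) x) (hZ : MDiffAt (T% Z) x) :
    inner ℝ (koszulConnection Y x (X x)) (Z x) = koszul Y X Z x := by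
  set B := TensorialAt.mkHom₂ (fun X Z => koszul Y X Z x) x
        (fun _ hZ => koszul_tensorial_left hY hZ)
        (fun _ hX => koszul_tensorial_right hY hX) with hB
  have h1 : B (X x) (Z x) = koszul Y X Z x := TensorialAt.mkHom₂_apply _ _ hX hZ
  rw [← h1]
  conv_rhs => rw [← (stdOrthonormalBasis ℝ (TangentSpace I x)).sum_repr' (Z x)]
  simp only [koszulConnection, dif_pos hY, map_sum, map_smul, ← hB]
  simp [sum_inner, real_inner_smul_left, mul_comm]

theorem koszulConnection_ext {x : M} {A B : TangentSpace I x →L[ℝ] TangentSpace I x}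
    (h : ∀ X Z : Π x : M, TangentSpace I x, MDiffAt (T% X) x → MDiffAt (T% Z) x →
      (inner ℝ (A (X x)) (Z x) : ℝ) = inner ℝ (B (X x)) (Z x)) : A = B := by
  ext v
  refine ext_inner_right ℝ fun w => ?_
  simpa using h _ _ (FiberBundle.mdifferentiableAt_extend I E v)
    (FiberBundle.mdifferentiableAt_extend I E w)

variable (I M) in
/-- The Levi-Civita connection of the Riemannian metric; `leviCivita I M Y x v` is `∇_v Y`. -/
def leviCivita : CovariantDerivative I E (fun x : M => TangentSpace I x) := by
  refine ⟨koszulConnection, ?_, ?_⟩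
  · intro Y Y' x hY hY' _
    refine koszulConnection_ext fun X Z hX hZ => ?_
    have hs := mdifferentiableAt_add_section hY hY'
    rw [inner_koszulConnection hs hX hZ, koszul_add hY hY' hX hZ]
    simp [inner_add_left, inner_koszulConnection, hY, hY', hX, hZ]
  · intro Y f x hY hf _
    refine koszulConnection_ext fun X Z hX hZ => ?_
    have hs := hf.smul_section hY
    rw [inner_koszulConnection hs hX hZ, koszul_smul hf hY hX hZ]
    simp [inner_add_left, real_inner_smul_left, inner_koszulConnection, hY, hX, hZ]

variable (I M) in
theorem isLeviCivita_leviCivita : IsLeviCivita (leviCivita I M) := by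
  refine ⟨?_, ?_⟩
  · refine (CovariantDerivative.isMetricCompatible_iff (V := fun x : M => TangentSpace I x) _).2 ?_
    intro x X Y Z hX hY hZ
    have h1 := inner_koszulConnection hY hX hZ
    have h2 := inner_koszulConnection hZ hX hY
    have h3 : (inner ℝ (Y x) (koszulConnection Z x (X x)) : ℝ) = koszul Z X Y x := by
      rw [← h2, real_inner_comm]
    change _ = (inner ℝ (koszulConnection Y x (X x)) (Z x) : ℝ)
      + inner ℝ (Y x) (koszulConnection Z x (X x))
    rw [h1, h3]
    simp only [koszul, mvfderiv_inner_comm Z Y, mlieBracket_swap_apply (V := Z) (W := Y),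
      inner_neg_left]
    ring
  · refine (CovariantDerivative.torsion_eq_zero_iff _).2 ?_
    intro X Y x hX hY
    refine ext_inner_right ℝ fun w => ?_
    have hw := FiberBundle.mdifferentiableAt_extend I E w
    have h1 := inner_koszulConnection hY hX hw
    have h2 := inner_koszulConnection hX hY hw
    rw [FiberBundle.extend_apply_self] at h1 h2
    change (inner ℝ (koszulConnection Y x (X x) - koszulConnection X x (Y x)) w : ℝ) = _
    rw [inner_sub_left, h1, h2]
    simp only [koszul, mvfderiv_inner_comm Y X, mlieBracket_swap_apply (V := Y) (W := X),
      inner_neg_left, FiberBundle.extend_apply_self]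
    ring

/-! ### Curvature -/

/-- `R(X, Y)Z = ∇_X ∇_Y Z - ∇_Y ∇_X Z - ∇_[X,Y] Z` for the Levi-Civita connection, evaluated
at `x`. -/
def curvature (X Y Z : Π x : M, TangentSpace I x) (x : M) : TangentSpace I x :=
  leviCivita I M (fun y => leviCivita I M Z y (Y y)) x (X x)
    - leviCivita I M (fun y => leviCivita I M Z y (X y)) x (Y x)
    - leviCivita I M Z x (mlieBracket I X Y x)

/-- The Riemann curvature tensor `R(u, v)w` on tangent vectors at `x`, computed by extending the
vectors to vector fields that are smooth near `x`. -/
def riemannTensor (x : M) (u v w : TangentSpace I x) : TangentSpace I x :=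
  curvature (FiberBundle.extend E u) (FiberBundle.extend E v) (FiberBundle.extend E w) x

/-- The Ricci curvature `Ric(v, w)`, the trace of `u ↦ R(u, v)w`. -/
def ricci (x : M) (v w : TangentSpace I x) : ℝ :=
  ∑ i, inner ℝ (riemannTensor x (stdOrthonormalBasis ℝ (TangentSpace I x) i) v w)
    (stdOrthonormalBasis ℝ (TangentSpace I x) i)

variable (I) in
/-- The scalar curvature at `x`: the trace of the Ricci curvature with respect to the metric. -/
def scalarCurvature (x : M) : ℝ :=
  ∑ j, ricci x (stdOrthonormalBasis ℝ (TangentSpace I x) j)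
    (stdOrthonormalBasis ℝ (TangentSpace I x) j)

/-! ### Orthonormal frames and structure functions -/

variable (I) in
/-- A smooth orthonormal frame of the tangent bundle over a set `U`. The values of the vector
fields outside `U` are irrelevant. -/
structure IsOrthonormalFrameOn {ι : Type*} (e : ι → Π x : M, TangentSpace I x) (U : Set M) :
    Prop where
  isLocalFrameOn : IsLocalFrameOn I E ∞ e U
  orthonormal : ∀ x ∈ U, Orthonormal ℝ (fun i => e i x)

variable (I) in
/-- The functions `c k i j` (written `c^k_{ij}`) are the structure functions of the frame `e` over
`U`: `[e_i, e_j] = ∑ k, c^k_{ij} e_k`. -/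
def IsStructureFunctionsOn {ι : Type*} [Fintype ι] (e : ι → Π x : M, TangentSpace I x)
    (c : ι → ι → ι → M → ℝ) (U : Set M) : Prop :=
  ∀ x ∈ U, ∀ i j, mlieBracket I (e i) (e j) x = ∑ k, c k i j x • e k x

end RiemannianScalar

end

namespace RiemannianScalar

open Filter Topology

section Frames

variable {E : Type*} [NormedAddCommGroup E] [NormedSpace ℝ E] [FiniteDimensional ℝ E]
  {H : Type*} [TopologicalSpace H] {I : ModelWithCorners ℝ E H}
  {M : Type*} [TopologicalSpace M] [ChartedSpace H M] [IsManifold I ∞ M]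
  [RiemannianBundle (fun x : M => TangentSpace I x)]
  [IsContMDiffRiemannianBundle I ∞ E (fun x : M => TangentSpace I x)]

/-! ### Germs of smooth functions and vector fields -/

/-! In an orthonormal frame the inner products are constant, so the Koszul formula expresses each
`⟨∇_{e_i} e_j, e_k⟩` through structure functions alone (`IsStructureFunctionsOn.inner_leviCivita`).
Metric compatibility gives `⟨∇_X W, e_i⟩ = X⟨W, e_i⟩ - ⟨W, ∇_X e_i⟩`. With `W = ∇_{e_j} e_j` and `W
= ∇_{e_i} e_j` this turns `⟨R(e_i,e_j)e_j, e_i⟩` into derivatives of structure functions plus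
quadratic terms (`IsStructureFunctionsOn.inner_curvature`). Summing over `i, j` and using
antisymmetry in the lower indices leaves the stated contractions (`sum_antisymm_eq`).

Most of the work goes into replacing the scalar curvature, defined through local extensions of
vectors of a standard orthonormal basis, by the double trace over the frame
(`IsOrthonormalFrameOn.scalarCurvature_eq`). This needs the curvature at a point to depend only on
the values of its arguments there. As it involves second derivatives, tensoriality is tested on
smooth fields and functions (`IsSmoothTensorialAt`), and the third slot requires `[X,Y]f = X(Yf) -
Y(Xf)`. -/

theorem mdiffAt_of_smooth {x : M} {X : Π x : M, TangentSpace I x} (hX : CMDiffAt ∞ (T% X) x) :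
    MDiffAt (T% X) x :=
  hX.mdifferentiableAt (by simp)

theorem eventually_mdiffAt {x : M} {X : Π x : M, TangentSpace I x} (hX : CMDiffAt ∞ (T% X) x) :
    ∀ᶠ y in 𝓝 x, MDiffAt (T% X) y := by
  have h1 : CMDiffAt 1 (T% X) x := hX.of_le (by simp)
  filter_upwards [(contMDiffAt_iff_contMDiffAt_nhds (by simp)).1 h1] with y hy
  exact hy.mdifferentiableAt (by simp)

theorem eventually_mdiffAt_function {x : M} {f : M → ℝ} (hf : CMDiffAt ∞ f x) :
    ∀ᶠ y in 𝓝 x, MDiffAt f y := by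
  have h1 : CMDiffAt 1 f x := hf.of_le (by simp)
  filter_upwards [(contMDiffAt_iff_contMDiffAt_nhds (by simp)).1 h1] with y hy
  exact hy.mdifferentiableAt (by simp)

theorem smooth_mlieBracket {x : M} {X Y : Π x : M, TangentSpace I x}
    (hX : CMDiffAt ∞ (T% X) x) (hY : CMDiffAt ∞ (T% Y) x) :
    CMDiffAt ∞ (T% (mlieBracket I X Y)) x := by
  have : IsManifold I (minSmoothness ℝ 2) M := IsManifold.of_le (n := ∞) (by
    rw [minSmoothness_of_isRCLikeNormedField]; exact ENat.LEInfty.out)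
  have : IsManifold I (((⊤ : ℕ∞) : ℕ∞ω) + 1) M := IsManifold.of_le (n := ∞) (by simp)
  exact ContMDiffAt.mlieBracket_vectorField (m := ⊤) (n := ⊤) hX hY (by simp)

theorem smooth_inner {x : M} {X Y : Π x : M, TangentSpace I x}
    (hX : CMDiffAt ∞ (T% X) x) (hY : CMDiffAt ∞ (T% Y) x) :
    CMDiffAt ∞ (fun y => (inner ℝ (X y) (Y y) : ℝ)) x :=
  ContMDiffAt.inner_bundle (IB := I) (IM := I) (M := M) (B := M) (b := fun x => x) (F := E)
    (E := fun x : M => TangentSpace I x) hX hY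

theorem mvfderiv_congr {x : M} {f g : M → ℝ} (h : f =ᶠ[𝓝 x] g) :
    mvfderiv I f x = mvfderiv I g x := by
  unfold mvfderiv
  rw [h.mfderiv_eq, h.eq_of_nhds]

/-! ### Expansion and smoothness in an orthonormal frame. -/

variable {ι : Type*} [Fintype ι] {e : ι → Π x : M, TangentSpace I x} {U : Set M}

theorem IsOrthonormalFrameOn.smooth (he : IsOrthonormalFrameOn I e U) (hU : IsOpen U) {x : M}
    (hx : x ∈ U) (i : ι) : CMDiffAt ∞ (T% (e i)) x :=
  he.isLocalFrameOn.contMDiffAt hU hx i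

/-- The orthonormal basis of the tangent space given by an orthonormal frame. -/
noncomputable def IsOrthonormalFrameOn.basis (he : IsOrthonormalFrameOn I e U) {x : M}
    (hx : x ∈ U) : OrthonormalBasis ι ℝ (TangentSpace I x) :=
  OrthonormalBasis.mk (he.orthonormal x hx) (he.isLocalFrameOn.generating hx)

theorem IsOrthonormalFrameOn.basis_apply (he : IsOrthonormalFrameOn I e U) {x : M}
    (hx : x ∈ U) (i : ι) : he.basis hx i = e i x := by
  simp [IsOrthonormalFrameOn.basis]

theorem IsOrthonormalFrameOn.sum_inner_smul (he : IsOrthonormalFrameOn I e U) {x : M}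
    (hx : x ∈ U) (v : TangentSpace I x) : ∑ i, (inner ℝ (e i x) v : ℝ) • e i x = v := by
  simpa only [he.basis_apply hx] using (he.basis hx).sum_repr' v

theorem IsOrthonormalFrameOn.sum_inner_mul_inner (he : IsOrthonormalFrameOn I e U) {x : M}
    (hx : x ∈ U) (v w : TangentSpace I x) :
    ∑ i, (inner ℝ v (e i x) : ℝ) * inner ℝ w (e i x) = inner ℝ v w := by
  have h := (he.basis hx).sum_inner_mul_inner v w
  simp only [he.basis_apply hx] at h
  rw [← h]
  refine Finset.sum_congr rfl fun i _ => ?_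
  rw [real_inner_comm w]

open scoped Classical in
theorem IsOrthonormalFrameOn.inner_eq (he : IsOrthonormalFrameOn I e U) {x : M}
    (hx : x ∈ U) (i j : ι) : (inner ℝ (e i x) (e j x) : ℝ) = if i = j then 1 else 0 :=
  orthonormal_iff_ite.1 (he.orthonormal x hx) i j

theorem IsOrthonormalFrameOn.mvfderiv_inner (he : IsOrthonormalFrameOn I e U) (hU : IsOpen U)
    {x : M} (hx : x ∈ U) (i j : ι) :
    mvfderiv I (fun y => (inner ℝ (e i y) (e j y) : ℝ)) x = 0 := by
  classical
  have h : (fun y => (inner ℝ (e i y) (e j y) : ℝ)) =ᶠ[𝓝 x] fun _ => if i = j then 1 else 0 := by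
    filter_upwards [hU.mem_nhds hx] with y hy using he.inner_eq hy i j
  rw [mvfderiv_congr h, mvfderiv_const]

/-- A vector field is smooth if its inner products with an orthonormal frame are. -/
theorem IsOrthonormalFrameOn.smooth_of_inner (he : IsOrthonormalFrameOn I e U) (hU : IsOpen U)
    {x : M} (hx : x ∈ U) {X : Π x : M, TangentSpace I x} {h : ι → M → ℝ}
    (hh : ∀ i, CMDiffAt ∞ (h i) x)
    (hX : ∀ᶠ y in 𝓝 x, ∀ i, (inner ℝ (X y) (e i y) : ℝ) = h i y) : CMDiffAt ∞ (T% X) x := by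
  have h1 : CMDiffAt ∞ (T% (fun y => ∑ i, (h i • e i) y)) x :=
    ContMDiffAt.sum_section fun i _ => (hh i).smul_section (he.smooth hU hx i)
  refine h1.congr_of_eventuallyEq ?_
  filter_upwards [hX, hU.mem_nhds hx] with y hy hyU
  simp only [TotalSpace.mk_inj]
  rw [← he.sum_inner_smul hyU (X y)]
  refine Finset.sum_congr rfl fun i _ => ?_
  rw [real_inner_comm, hy i]
  rfl

/-- The derivative of a smooth function along a smooth vector field is smooth. -/
theorem IsOrthonormalFrameOn.smooth_mvfderiv (he : IsOrthonormalFrameOn I e U) (hU : IsOpen U)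
    {x : M} (hx : x ∈ U) {X : Π x : M, TangentSpace I x} {f : M → ℝ}
    (hf : CMDiffAt ∞ f x) (hX : CMDiffAt ∞ (T% X) x) :
    CMDiffAt ∞ (fun y => mvfderiv I f y (X y)) x := by
  have h1 : CMDiffAt ∞ (fun y => ∑ i, (inner ℝ (e i y) (X y) : ℝ) *
      inner ℝ (mlieBracket I (e i) (f • e i) y) (e i y)) x := by
    refine ContMDiffAt.sum fun i _ => ?_
    have hi := he.smooth hU hx i
    exact (smooth_inner hi hX).mul
      (smooth_inner (smooth_mlieBracket hi (hf.smul_section hi)) hi)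
  refine h1.congr_of_eventuallyEq ?_
  filter_upwards [hU.mem_nhds hx, eventually_mdiffAt_function hf] with y hy hfy
  conv_lhs => rw [← he.sum_inner_smul hy (X y)]
  simp only [map_sum, map_smul]
  refine Finset.sum_congr rfl fun i _ => ?_
  rw [mlieBracket_smul_right hfy (mdiffAt_of_smooth (he.smooth hU hy i))]
  classical
  simp only [mlieBracket_self, Pi.zero_apply, smul_zero, add_zero, real_inner_smul_left,
    he.inner_eq hy, if_true, mul_one, smul_eq_mul]

/-! ### The commutator of derivations -/

/-- `[X, Y] f = X (Y f) - Y (X f)`. -/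
theorem IsOrthonormalFrameOn.mvfderiv_mlieBracket (he : IsOrthonormalFrameOn I e U)
    (hU : IsOpen U) {x : M} (hx : x ∈ U) {X Y : Π x : M, TangentSpace I x} {f : M → ℝ}
    (hf : CMDiffAt ∞ f x) (hX : CMDiffAt ∞ (T% X) x) (hY : CMDiffAt ∞ (T% Y) x) :
    mvfderiv I f x (mlieBracket I X Y x) =
      mvfderiv I (fun y => mvfderiv I f y (Y y)) x (X x)
        - mvfderiv I (fun y => mvfderiv I f y (X y)) x (Y x) := by
  -- The argument below needs one nonvanishing frame field; without any, the tangent space is zero.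
  rcases isEmpty_or_nonempty ι with hι | ⟨⟨i⟩⟩
  · have h0 : ∀ v : TangentSpace I x, v = 0 := fun v => by
      rw [← he.sum_inner_smul hx v]; simp
    rw [h0 (mlieBracket I X Y x), h0 (X x), h0 (Y x)]
    simp
  -- The two first-order terms together are symmetric in `A` and `B`, so they cancel from the Jacobi
  -- identity for `X, Y, f e_i`. Subtracting `f` times the identity for `X, Y, e_i` leaves only
  -- multiples of `e_i`, whose coefficients give the claim.
  have key : ∀ {A B : Π x : M, TangentSpace I x}, CMDiffAt ∞ (T% A) x → CMDiffAt ∞ (T% B) x →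
      mlieBracket I A (mlieBracket I B (f • e i)) x =
        mvfderiv I (fun y => mvfderiv I f y (B y)) x (A x) • e i x
        + mvfderiv I f x (B x) • mlieBracket I A (e i) x
        + (mvfderiv I f x (A x) • mlieBracket I B (e i) x
        + f x • mlieBracket I A (mlieBracket I B (e i)) x) := by
    intro A B hA hB
    have hi := he.smooth hU hx i
    have hBf := he.smooth_mvfderiv hU hx hf hB
    have hBi := smooth_mlieBracket hB hi
    have h1 : mlieBracket I B (f • e i) =ᶠ[𝓝 x]
        (fun y => mvfderiv I f y (B y)) • e i + f • mlieBracket I B (e i) := by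
      filter_upwards [eventually_mdiffAt_function hf, eventually_mdiffAt hi] with y hfy hiy
      rw [mlieBracket_smul_right hfy hiy]
      rfl
    rw [EventuallyEq.rfl.mlieBracket_vectorField_eq h1,
      mlieBracket_add_right (mdiffAt_of_smooth (hBf.smul_section hi))
        (mdiffAt_of_smooth (hf.smul_section hBi)),
      mlieBracket_smul_right (hBf.mdifferentiableAt (by simp)) (mdiffAt_of_smooth hi),
      mlieBracket_smul_right (hf.mdifferentiableAt (by simp)) (mdiffAt_of_smooth hBi)]
  have : IsManifold I (minSmoothness ℝ 3) M := IsManifold.of_le (n := ∞) (by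
    rw [minSmoothness_of_isRCLikeNormedField]; exact ENat.LEInfty.out)
  have hle : minSmoothness ℝ 2 ≤ ∞ := by
    rw [minSmoothness_of_isRCLikeNormedField]; exact ENat.LEInfty.out
  have hi := he.smooth hU hx i
  have J1 := leibniz_identity_mlieBracket_apply (hX.of_le hle) (hY.of_le hle)
    ((hf.smul_section hi).of_le hle)
  have J2 := leibniz_identity_mlieBracket_apply (hX.of_le hle) (hY.of_le hle) (hi.of_le hle)
  rw [key hX hY, key hY hX, mlieBracket_smul_right (hf.mdifferentiableAt (by simp))
    (mdiffAt_of_smooth hi), J2] at J1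
  have J3 := congrArg (fun v => (inner ℝ v (e i x) : ℝ)) J1
  classical
  simp only [inner_add_left, real_inner_smul_left, he.inner_eq hx, if_true, smul_add] at J3
  linarith

end Frames

section Curvature

variable {E : Type*} [NormedAddCommGroup E] [NormedSpace ℝ E] [FiniteDimensional ℝ E]
  {H : Type*} [TopologicalSpace H] {I : ModelWithCorners ℝ E H}
  {M : Type*} [TopologicalSpace M] [ChartedSpace H M] [IsManifold I ∞ M]
  [RiemannianBundle (fun x : M => TangentSpace I x)]
  [IsContMDiffRiemannianBundle I ∞ E (fun x : M => TangentSpace I x)]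
  {ι : Type*} [Fintype ι] {e : ι → Π x : M, TangentSpace I x} {U : Set M}

/-! ### Operations that are linear over functions smooth at a point -/

variable (I) in
/-- An operation on vector fields that are smooth at `x` is tensorial at `x` if it is additive and
homogeneous over functions that are smooth at `x`. -/
structure IsSmoothTensorialAt {A : Type*} [AddCommGroup A] [Module ℝ A]
    (Φ : (Π x : M, TangentSpace I x) → A) (x : M) : Prop where
  smul : ∀ {f : M → ℝ} {X : Π x : M, TangentSpace I x}, CMDiffAt ∞ f x → CMDiffAt ∞ (T% X) x →
    Φ (f • X) = f x • Φ X
  add : ∀ {X Y : Π x : M, TangentSpace I x}, CMDiffAt ∞ (T% X) x → CMDiffAt ∞ (T% Y) x →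
    Φ (X + Y) = Φ X + Φ Y

namespace IsSmoothTensorialAt

variable {A : Type*} [AddCommGroup A] [Module ℝ A] {Φ : (Π x : M, TangentSpace I x) → A} {x : M}

/-- Multiply by the indicator `ψ` of the set where the fields agree: it equals 1 near `x`, hence is
smooth at `x`, and `ψ • X = ψ • Y` everywhere. -/
theorem congr (h : IsSmoothTensorialAt I Φ x) {X Y : Π x : M, TangentSpace I x}
    (hX : CMDiffAt ∞ (T% X) x) (hY : CMDiffAt ∞ (T% Y) x) (hXY : ∀ᶠ y in 𝓝 x, X y = Y y) :
    Φ X = Φ Y := by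
  classical
  let ψ : M → ℝ := fun y => if X y = Y y then 1 else 0
  have hψx : ψ x = 1 := if_pos hXY.self_of_nhds
  have hψ : CMDiffAt ∞ ψ x := by
    refine (contMDiffAt_const (c := (1 : ℝ))).congr_of_eventuallyEq ?_
    filter_upwards [hXY] with y hy using if_pos hy
  have h1 : ψ • X = ψ • Y := by
    funext y
    by_cases hy : X y = Y y <;> simp [ψ, hy]
  have h2 := h.smul hψ hX
  rw [h1, h.smul hψ hY, hψx, one_smul, one_smul] at h2
  exact h2.symm

theorem zero (h : IsSmoothTensorialAt I Φ x) : Φ 0 = 0 := by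
  have h0 : CMDiffAt ∞ (T% (0 : Π x : M, TangentSpace I x)) x :=
    (contMDiff_zeroSection ℝ (fun x : M => TangentSpace I x)).contMDiffAt
  simpa using h.add h0 h0

theorem sum (h : IsSmoothTensorialAt I Φ x) {κ : Type*} (s : Finset κ)
    {X : κ → Π x : M, TangentSpace I x} (hX : ∀ i, CMDiffAt ∞ (T% (X i)) x) :
    Φ (fun y => ∑ i ∈ s, X i y) = ∑ i ∈ s, Φ (X i) := by
  classical
  induction s using Finset.induction_on with
  | empty => exact h.zero
  | insert a s ha ih =>
    simp only [Finset.sum_insert ha]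
    rw [← ih]
    exact h.add (hX a) (ContMDiffAt.sum_section fun i _ => hX i)

/-- The frame expansion holds only on `U`, so `congr` is needed before additivity and homogeneity
apply. -/
theorem eq_sum (h : IsSmoothTensorialAt I Φ x) (he : IsOrthonormalFrameOn I e U) (hU : IsOpen U)
    (hx : x ∈ U) {X : Π x : M, TangentSpace I x} (hX : CMDiffAt ∞ (T% X) x) :
    Φ X = ∑ i, (inner ℝ (e i x) (X x) : ℝ) • Φ (e i) := by
  have hs : ∀ i, CMDiffAt ∞ (fun y => (inner ℝ (e i y) (X y) : ℝ)) x := fun i =>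
    smooth_inner (he.smooth hU hx i) hX
  have ht : ∀ i, CMDiffAt ∞ (T% ((fun y => (inner ℝ (e i y) (X y) : ℝ)) • e i)) x := fun i =>
    (hs i).smul_section (he.smooth hU hx i)
  have h1 : ∀ᶠ y in 𝓝 x, X y = ∑ i, ((fun y => (inner ℝ (e i y) (X y) : ℝ)) • e i) y := by
    filter_upwards [hU.mem_nhds hx] with y hy using (he.sum_inner_smul hy (X y)).symm
  rw [h.congr hX (ContMDiffAt.sum_section fun i _ => ht i) h1, h.sum _ ht]
  exact Finset.sum_congr rfl fun i _ => h.smul (hs i) (he.smooth hU hx i)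

theorem pointwise (h : IsSmoothTensorialAt I Φ x) (he : IsOrthonormalFrameOn I e U)
    (hU : IsOpen U) (hx : x ∈ U) {X Y : Π x : M, TangentSpace I x}
    (hX : CMDiffAt ∞ (T% X) x) (hY : CMDiffAt ∞ (T% Y) x) (hXY : X x = Y x) : Φ X = Φ Y := by
  rw [h.eq_sum he hU hx hX, h.eq_sum he hU hx hY, hXY]

end IsSmoothTensorialAt

/-! ### The Levi-Civita connection on smooth vector fields -/

theorem inner_leviCivita {x : M} {X Y Z : Π x : M, TangentSpace I x}
    (hY : MDiffAt (T% Y) x) (hX : MDiffAt (T% X) x) (hZ : MDiffAt (T% Z) x) :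
    inner ℝ (leviCivita I M Y x (X x)) (Z x) = koszul Y X Z x :=
  inner_koszulConnection hY hX hZ

theorem leviCivita_add {x : M} {X Y : Π x : M, TangentSpace I x}
    (hX : MDiffAt (T% X) x) (hY : MDiffAt (T% Y) x) :
    leviCivita I M (X + Y) x = leviCivita I M X x + leviCivita I M Y x :=
  (leviCivita I M).isCovariantDerivativeOnUniv.add hX hY

theorem leviCivita_smul {x : M} {X : Π x : M, TangentSpace I x} {f : M → ℝ}
    (hX : MDiffAt (T% X) x) (hf : MDiffAt f x) (v : TangentSpace I x) :
    leviCivita I M (f • X) x v = f x • leviCivita I M X x v + mvfderiv I f x v • X x := by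
  rw [(leviCivita I M).isCovariantDerivativeOnUniv.leibniz hX hf]
  rfl

theorem leviCivita_congr {x : M} {X Y : Π x : M, TangentSpace I x}
    (hX : MDiffAt (T% X) x) (hY : MDiffAt (T% Y) x) (h : ∀ᶠ y in 𝓝 x, X y = Y y) :
    leviCivita I M X x = leviCivita I M Y x :=
  (leviCivita I M).isCovariantDerivativeOnUniv.congr_of_eventuallyEq hX hY univ_mem h

theorem mvfderiv_inner_leviCivita {x : M} {X Y Z : Π x : M, TangentSpace I x}
    (hY : MDiffAt (T% Y) x) (hZ : MDiffAt (T% Z) x) :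
    mvfderiv I (fun y => (inner ℝ (Y y) (Z y) : ℝ)) x (X x) =
      inner ℝ (leviCivita I M Y x (X x)) (Z x) + inner ℝ (Y x) (leviCivita I M Z x (X x)) :=
  (isLeviCivita_leviCivita I M).1.mvfderiv_inner_eq X hY hZ

/-- The components against the frame are Koszul expressions, built from derivatives, inner products
and brackets of smooth fields. -/
theorem IsOrthonormalFrameOn.smooth_leviCivita (he : IsOrthonormalFrameOn I e U) (hU : IsOpen U)
    {x : M} (hx : x ∈ U) {X Y : Π x : M, TangentSpace I x}
    (hY : CMDiffAt ∞ (T% Y) x) (hX : CMDiffAt ∞ (T% X) x) :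
    CMDiffAt ∞ (T% (fun y => leviCivita I M Y y (X y))) x := by
  refine he.smooth_of_inner hU hx (h := fun i => koszul Y X (e i)) (fun i => ?_) ?_
  · have hi := he.smooth hU hx i
    unfold koszul
    refine contMDiffAt_const.mul
      (.sub (.sub (.add (.sub (.add ?_ ?_) ?_) ?_) ?_) ?_)
    · exact he.smooth_mvfderiv hU hx (smooth_inner hY hi) hX
    · exact he.smooth_mvfderiv hU hx (smooth_inner hX hi) hY
    · exact he.smooth_mvfderiv hU hx (smooth_inner hX hY) hi
    · exact smooth_inner (smooth_mlieBracket hX hY) hi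
    · exact smooth_inner (smooth_mlieBracket hX hi) hY
    · exact smooth_inner (smooth_mlieBracket hY hi) hX
  · filter_upwards [eventually_mdiffAt hX, eventually_mdiffAt hY, hU.mem_nhds hx]
      with y hXy hYy hyU i
    exact inner_leviCivita hYy hXy (mdiffAt_of_smooth (he.smooth hU hyU i))

/-! ### The curvature is a tensor -/

theorem curvature_swap (X Y Z : Π x : M, TangentSpace I x) (x : M) :
    curvature X Y Z x = -curvature Y X Z x := by
  simp only [curvature, mlieBracket_swap_apply (V := X) (W := Y), map_neg]
  abel

/-- The term `(Yf) ∇_X Z` produced by `∇_Y (f ∇_X Z)` cancels the one coming from `[fX, Y] = f[X,Y]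
- (Yf)X`. -/
theorem IsOrthonormalFrameOn.curvature_tensorial₁ (he : IsOrthonormalFrameOn I e U)
    (hU : IsOpen U) {x : M} (hx : x ∈ U) {Y Z : Π x : M, TangentSpace I x}
    (hZ : CMDiffAt ∞ (T% Z) x) :
    IsSmoothTensorialAt I (fun X => curvature X Y Z x) x where
  smul {f X} hf hX := by
    have h1 : (fun y => leviCivita I M Z y ((f • X) y)) =
        f • fun y => leviCivita I M Z y (X y) := by
      funext y
      exact map_smul _ _ _
    have hc := he.smooth_leviCivita hU hx hZ hX
    simp only [curvature]
    rw [h1, leviCivita_smul (mdiffAt_of_smooth hc) (hf.mdifferentiableAt (by simp)),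
      mlieBracket_smul_left (hf.mdifferentiableAt (by simp)) (mdiffAt_of_smooth hX)]
    simp only [Pi.smul_apply', map_smul, map_add]
    module
  add {X X'} hX hX' := by
    have h1 : (fun y => leviCivita I M Z y ((X + X') y)) =
        (fun y => leviCivita I M Z y (X y)) + fun y => leviCivita I M Z y (X' y) := by
      funext y
      exact map_add _ _ _
    simp only [curvature]
    rw [h1, leviCivita_add (mdiffAt_of_smooth (he.smooth_leviCivita hU hx hZ hX))
        (mdiffAt_of_smooth (he.smooth_leviCivita hU hx hZ hX')),
      mlieBracket_add_left (mdiffAt_of_smooth hX) (mdiffAt_of_smooth hX')]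
    simp only [Pi.add_apply, map_add, add_apply]
    abel

theorem IsOrthonormalFrameOn.curvature_tensorial₂ (he : IsOrthonormalFrameOn I e U)
    (hU : IsOpen U) {x : M} (hx : x ∈ U) {X Z : Π x : M, TangentSpace I x}
    (hZ : CMDiffAt ∞ (T% Z) x) :
    IsSmoothTensorialAt I (fun Y => curvature X Y Z x) x where
  smul {f Y} hf hY := by
    simp only [curvature_swap X]
    rw [(he.curvature_tensorial₁ hU hx hZ).smul hf hY, smul_neg]
  add {Y Y'} hY hY' := by
    simp only [curvature_swap X]
    rw [(he.curvature_tensorial₁ hU hx hZ).add hY hY', neg_add]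

/-- The two terms with one derivative on `f` are jointly symmetric in `X` and `Y`, so
antisymmetrising keeps only the second derivatives of `f`; in `curvature_tensorial₃` these cancel
against `([X,Y]f) Z`. -/
theorem IsOrthonormalFrameOn.leviCivita_leviCivita_smul (he : IsOrthonormalFrameOn I e U)
    (hU : IsOpen U) {x : M} (hx : x ∈ U) {X Y Z : Π x : M, TangentSpace I x} {f : M → ℝ}
    (hY : CMDiffAt ∞ (T% Y) x) (hZ : CMDiffAt ∞ (T% Z) x)
    (hf : CMDiffAt ∞ f x) :
    leviCivita I M (fun y => leviCivita I M (f • Z) y (Y y)) x (X x) =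
      f x • leviCivita I M (fun y => leviCivita I M Z y (Y y)) x (X x)
        + mvfderiv I f x (X x) • leviCivita I M Z x (Y x)
        + (mvfderiv I f x (Y x) • leviCivita I M Z x (X x)
        + mvfderiv I (fun y => mvfderiv I f y (Y y)) x (X x) • Z x) := by
  have hfY := he.smooth_mvfderiv hU hx hf hY
  have hZY := he.smooth_leviCivita hU hx hZ hY
  have h1 : ∀ᶠ y in 𝓝 x, leviCivita I M (f • Z) y (Y y) =
      (f • (fun y => leviCivita I M Z y (Y y)) + (fun y => mvfderiv I f y (Y y)) • Z) y := by
    filter_upwards [eventually_mdiffAt hZ, eventually_mdiffAt_function hf] with y hZy hfy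
    exact leviCivita_smul hZy hfy _
  have h2 := mdiffAt_of_smooth (hf.smul_section hZY)
  have h3 := mdiffAt_of_smooth (hfY.smul_section hZ)
  rw [leviCivita_congr
      (mdiffAt_of_smooth (he.smooth_leviCivita hU hx (hf.smul_section hZ) hY))
      (mdifferentiableAt_add_section h2 h3) h1,
    leviCivita_add h2 h3, add_apply,
    leviCivita_smul (mdiffAt_of_smooth hZY) (hf.mdifferentiableAt (by simp)),
    leviCivita_smul (mdiffAt_of_smooth hZ) (hfY.mdifferentiableAt (by simp))]

theorem IsOrthonormalFrameOn.leviCivita_leviCivita_add (he : IsOrthonormalFrameOn I e U)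
    (hU : IsOpen U) {x : M} (hx : x ∈ U) {X Y Z Z' : Π x : M, TangentSpace I x}
    (hY : CMDiffAt ∞ (T% Y) x) (hZ : CMDiffAt ∞ (T% Z) x) (hZ' : CMDiffAt ∞ (T% Z') x) :
    leviCivita I M (fun y => leviCivita I M (Z + Z') y (Y y)) x (X x) =
      leviCivita I M (fun y => leviCivita I M Z y (Y y)) x (X x)
        + leviCivita I M (fun y => leviCivita I M Z' y (Y y)) x (X x) := by
  have h1 : ∀ᶠ y in 𝓝 x, leviCivita I M (Z + Z') y (Y y) =
      ((fun y => leviCivita I M Z y (Y y)) + fun y => leviCivita I M Z' y (Y y)) y := by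
    filter_upwards [eventually_mdiffAt hZ, eventually_mdiffAt hZ'] with y hZy hZy'
    rw [leviCivita_add hZy hZy']
    rfl
  have h2 := mdiffAt_of_smooth (he.smooth_leviCivita hU hx hZ hY)
  have h3 := mdiffAt_of_smooth (he.smooth_leviCivita hU hx hZ' hY)
  rw [leviCivita_congr
      (mdiffAt_of_smooth (he.smooth_leviCivita hU hx (hZ.add_section hZ') hY))
      (mdifferentiableAt_add_section h2 h3) h1,
    leviCivita_add h2 h3, add_apply]

theorem IsOrthonormalFrameOn.curvature_tensorial₃ (he : IsOrthonormalFrameOn I e U)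
    (hU : IsOpen U) {x : M} (hx : x ∈ U) {X Y : Π x : M, TangentSpace I x}
    (hX : CMDiffAt ∞ (T% X) x) (hY : CMDiffAt ∞ (T% Y) x) :
    IsSmoothTensorialAt I (fun Z => curvature X Y Z x) x where
  smul {f Z} hf hZ := by
    simp only [curvature]
    rw [he.leviCivita_leviCivita_smul hU hx hY hZ hf,
      he.leviCivita_leviCivita_smul hU hx hX hZ hf,
      leviCivita_smul (mdiffAt_of_smooth hZ) (hf.mdifferentiableAt (by simp)),
      he.mvfderiv_mlieBracket hU hx hf hX hY]
    module
  add {Z Z'} hZ hZ' := by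
    simp only [curvature]
    rw [he.leviCivita_leviCivita_add hU hx hY hZ hZ',
      he.leviCivita_leviCivita_add hU hx hX hZ hZ',
      leviCivita_add (mdiffAt_of_smooth hZ) (mdiffAt_of_smooth hZ'),
      add_apply]
    abel

/-! ### Independence of the chosen extensions. -/

theorem smooth_extend {x : M} (v : TangentSpace I x) :
    CMDiffAt ∞ (T% (FiberBundle.extend E v)) x :=
  FiberBundle.contMDiffAt_extend I E v

theorem IsOrthonormalFrameOn.riemannTensor_eq (he : IsOrthonormalFrameOn I e U)
    (hU : IsOpen U) {x : M} (hx : x ∈ U) {X Y Z : Π x : M, TangentSpace I x}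
    (hX : CMDiffAt ∞ (T% X) x) (hY : CMDiffAt ∞ (T% Y) x) (hZ : CMDiffAt ∞ (T% Z) x) :
    riemannTensor x (X x) (Y x) (Z x) = curvature X Y Z x := by
  unfold riemannTensor
  rw [(he.curvature_tensorial₁ hU hx (smooth_extend _)).pointwise he hU hx
      (smooth_extend _) hX (FiberBundle.extend_apply_self E _),
    (he.curvature_tensorial₂ hU hx (smooth_extend _)).pointwise he hU hx
      (smooth_extend _) hY (FiberBundle.extend_apply_self E _),
    (he.curvature_tensorial₃ hU hx hX hY).pointwise he hU hx
      (smooth_extend _) hZ (FiberBundle.extend_apply_self E _)]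

end Curvature

/-! ### Traces in orthonormal bases -/

/-- Expand each `b i` in `b'`; summing over `i` first, Parseval for `b` turns the coefficients into
`⟨b' k, b' l⟩`, which is 1 or 0. -/
theorem sum_bilin_orthonormalBasis {V ι κ : Type*} [NormedAddCommGroup V] [InnerProductSpace ℝ V]
    [Fintype ι] [Fintype κ] (b : OrthonormalBasis ι ℝ V) (b' : OrthonormalBasis κ ℝ V)
    (B : V →ₗ[ℝ] V →ₗ[ℝ] ℝ) : ∑ i, B (b i) (b i) = ∑ k, B (b' k) (b' k) := by
  classical
  have h1 : ∀ i, B (b i) (b i) =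
      ∑ k, ∑ l, (inner ℝ (b' k) (b i) * inner ℝ (b i) (b' l)) * B (b' k) (b' l) := by
    intro i
    conv_lhs => rw [← b'.sum_repr' (b i)]
    simp only [map_sum, map_smul, LinearMap.sum_apply, LinearMap.smul_apply, smul_eq_mul,
      Finset.mul_sum]
    rw [Finset.sum_comm]
    refine Finset.sum_congr rfl fun k _ => Finset.sum_congr rfl fun l _ => ?_
    rw [real_inner_comm (b i) (b' l)]
    ring
  simp only [h1]
  rw [Finset.sum_comm]
  refine Finset.sum_congr rfl fun k _ => ?_
  rw [Finset.sum_comm]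
  simp only [← Finset.sum_mul, b.sum_inner_mul_inner, orthonormal_iff_ite.1 b'.orthonormal]
  simp

/-! ### Scalar curvature as a trace over the frame, and its expression by structure functions. -/

section Scalar

variable {E : Type*} [NormedAddCommGroup E] [NormedSpace ℝ E] [FiniteDimensional ℝ E]
  {H : Type*} [TopologicalSpace H] {I : ModelWithCorners ℝ E H}
  {M : Type*} [TopologicalSpace M] [ChartedSpace H M] [IsManifold I ∞ M]
  [RiemannianBundle (fun x : M => TangentSpace I x)]
  [IsContMDiffRiemannianBundle I ∞ E (fun x : M => TangentSpace I x)]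
  {ι : Type*} [Fintype ι] {e : ι → Π x : M, TangentSpace I x} {U : Set M}

/-- The extension of `a + b` need only agree with the sum of the extensions at `x`, and `pointwise`
says that this suffices. -/
theorem IsOrthonormalFrameOn.riemannTensor_linear₁ (he : IsOrthonormalFrameOn I e U)
    (hU : IsOpen U) {x : M} (hx : x ∈ U) (v w : TangentSpace I x) :
    IsLinearMap ℝ fun u => riemannTensor x u v w := by
  have ht := he.curvature_tensorial₁ hU hx (Y := FiberBundle.extend E v) (smooth_extend w)
  refine ⟨fun a b => ?_, fun a b => ?_⟩
  · have h := ht.add (smooth_extend a) (smooth_extend b)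
    refine Eq.trans ?_ h
    exact ht.pointwise he hU hx (smooth_extend _) ((smooth_extend a).add_section (smooth_extend b))
      (by simp)
  · have h := ht.smul (contMDiffAt_const (c := a)) (smooth_extend b)
    refine Eq.trans ?_ h
    exact ht.pointwise he hU hx (smooth_extend _)
      ((contMDiffAt_const (c := a)).smul_section (smooth_extend b)) (by simp)

theorem IsOrthonormalFrameOn.riemannTensor_linear₂ (he : IsOrthonormalFrameOn I e U)
    (hU : IsOpen U) {x : M} (hx : x ∈ U) (u w : TangentSpace I x) :
    IsLinearMap ℝ fun v => riemannTensor x u v w := by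
  have ht := he.curvature_tensorial₂ hU hx (X := FiberBundle.extend E u) (smooth_extend w)
  refine ⟨fun a b => ?_, fun a b => ?_⟩
  · have h := ht.add (smooth_extend a) (smooth_extend b)
    refine Eq.trans ?_ h
    exact ht.pointwise he hU hx (smooth_extend _) ((smooth_extend a).add_section (smooth_extend b))
      (by simp)
  · have h := ht.smul (contMDiffAt_const (c := a)) (smooth_extend b)
    refine Eq.trans ?_ h
    exact ht.pointwise he hU hx (smooth_extend _)
      ((contMDiffAt_const (c := a)).smul_section (smooth_extend b)) (by simp)

theorem IsOrthonormalFrameOn.riemannTensor_linear₃ (he : IsOrthonormalFrameOn I e U)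
    (hU : IsOpen U) {x : M} (hx : x ∈ U) (u v : TangentSpace I x) :
    IsLinearMap ℝ fun w => riemannTensor x u v w := by
  have ht := he.curvature_tensorial₃ hU hx (smooth_extend u) (smooth_extend v)
  refine ⟨fun a b => ?_, fun a b => ?_⟩
  · have h := ht.add (smooth_extend a) (smooth_extend b)
    refine Eq.trans ?_ h
    exact ht.pointwise he hU hx (smooth_extend _) ((smooth_extend a).add_section (smooth_extend b))
      (by simp)
  · have h := ht.smul (contMDiffAt_const (c := a)) (smooth_extend b)
    refine Eq.trans ?_ h
    exact ht.pointwise he hU hx (smooth_extend _)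
      ((contMDiffAt_const (c := a)).smul_section (smooth_extend b)) (by simp)

/-- The scalar curvature is the double trace of the curvature in any orthonormal frame. -/
theorem IsOrthonormalFrameOn.scalarCurvature_eq (he : IsOrthonormalFrameOn I e U)
    (hU : IsOpen U) {x : M} (hx : x ∈ U) :
    scalarCurvature I x = ∑ i, ∑ j, inner ℝ (curvature (e i) (e j) (e j) x) (e i x) := by
  have L1 := he.riemannTensor_linear₁ hU hx
  have L2 := he.riemannTensor_linear₂ hU hx
  have L3 := he.riemannTensor_linear₃ hU hx
  -- The basis is changed in the inner trace first, then in the outer one.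
  have hric : ∀ v w : TangentSpace I x, ricci x v w =
      ∑ i, inner ℝ (riemannTensor x (e i x) v w) (e i x) := by
    intro v w
    let B : TangentSpace I x →ₗ[ℝ] TangentSpace I x →ₗ[ℝ] ℝ :=
      LinearMap.mk₂ ℝ (fun u z => inner ℝ (riemannTensor x u v w) z)
        (fun a b z => by rw [(L1 v w).map_add, inner_add_left])
        (fun c a z => by rw [(L1 v w).map_smul, real_inner_smul_left]; rfl)
        (fun a y z => inner_add_right _ _ _)
        (fun c a z => real_inner_smul_right _ _ _)
    have h := sum_bilin_orthonormalBasis (stdOrthonormalBasis ℝ (TangentSpace I x))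
      (he.basis hx) B
    simp only [he.basis_apply hx] at h
    exact h
  let B : TangentSpace I x →ₗ[ℝ] TangentSpace I x →ₗ[ℝ] ℝ :=
    LinearMap.mk₂ ℝ (fun v w => ∑ i, inner ℝ (riemannTensor x (e i x) v w) (e i x))
      (fun a b z => by
        simp only [(L2 _ _).map_add, inner_add_left, Finset.sum_add_distrib])
      (fun c a z => by
        simp only [(L2 _ _).map_smul, real_inner_smul_left, Finset.mul_sum, smul_eq_mul])
      (fun a y z => by
        simp only [(L3 _ _).map_add, inner_add_left, Finset.sum_add_distrib])
      (fun c a z => by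
        simp only [(L3 _ _).map_smul, real_inner_smul_left, Finset.mul_sum, smul_eq_mul])
  have h := sum_bilin_orthonormalBasis (stdOrthonormalBasis ℝ (TangentSpace I x))
    (he.basis hx) B
  simp only [he.basis_apply hx] at h
  simp only [scalarCurvature, hric]
  refine h.trans ?_
  rw [Finset.sum_comm]
  refine Finset.sum_congr rfl fun j _ => Finset.sum_congr rfl fun i _ => ?_
  rw [he.riemannTensor_eq hU hx (he.smooth hU hx _) (he.smooth hU hx _) (he.smooth hU hx _)]

/-! ### Structure functions -/

variable {c : ι → ι → ι → M → ℝ}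

theorem IsStructureFunctionsOn.eq_inner (hc : IsStructureFunctionsOn I e c U)
    (he : IsOrthonormalFrameOn I e U) {x : M} (hx : x ∈ U) (k i j : ι) :
    c k i j x = inner ℝ (mlieBracket I (e i) (e j) x) (e k x) := by
  classical
  rw [hc x hx i j, sum_inner]
  simp [real_inner_smul_left, he.inner_eq hx]

theorem IsStructureFunctionsOn.swap (hc : IsStructureFunctionsOn I e c U)
    (he : IsOrthonormalFrameOn I e U) {x : M} (hx : x ∈ U) (k i j : ι) :
    c k i j x = -c k j i x := by
  rw [hc.eq_inner he hx, hc.eq_inner he hx, mlieBracket_swap_apply, inner_neg_left]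

theorem IsStructureFunctionsOn.mvfderiv_swap (hc : IsStructureFunctionsOn I e c U)
    (he : IsOrthonormalFrameOn I e U) (hU : IsOpen U) {x : M} (hx : x ∈ U) (k i j : ι)
    (v : TangentSpace I x) : mvfderiv I (c k i j) x v = -mvfderiv I (c k j i) x v := by
  have h : c k i j =ᶠ[𝓝 x] -c k j i := by
    filter_upwards [hU.mem_nhds hx] with y hy using hc.swap he hy k i j
  rw [mvfderiv_congr h, mvfderiv_neg]
  rfl

/-- The connection coefficients of an orthonormal frame in terms of its structure functions. -/
theorem IsStructureFunctionsOn.inner_leviCivita (hc : IsStructureFunctionsOn I e c U)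
    (he : IsOrthonormalFrameOn I e U) (hU : IsOpen U) {x : M} (hx : x ∈ U) (i j k : ι) :
    inner ℝ (leviCivita I M (e j) x (e i x)) (e k x) =
      1 / 2 * (c k i j x - c j i k x - c i j k x) := by
  have hd := fun i => mdiffAt_of_smooth (he.smooth hU hx i)
  -- The three derivative terms of the Koszul expression vanish, the inner products being locally
  -- constant.
  rw [RiemannianScalar.inner_leviCivita (hd j) (hd i) (hd k), koszul, he.mvfderiv_inner hU hx,
    he.mvfderiv_inner hU hx, he.mvfderiv_inner hU hx, hc.eq_inner he hx, hc.eq_inner he hx,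
    hc.eq_inner he hx]
  simp

/-- The sectional curvatures of the planes of an orthonormal frame in terms of its structure
functions. -/
theorem IsStructureFunctionsOn.inner_curvature (hc : IsStructureFunctionsOn I e c U)
    (he : IsOrthonormalFrameOn I e U) (hU : IsOpen U) {x : M} (hx : x ∈ U) (i j : ι) :
    inner ℝ (curvature (e i) (e j) (e j) x) (e i x) =
      mvfderiv I (c j i j) x (e i x) + mvfderiv I (c i j i) x (e j x)
        - ∑ k, c j k j x * c i k i x
        + ∑ k, 1 / 4 * ((c i j k x + c j i k x) ^ 2 - c k i j x ^ 2)
        - ∑ k, c k i j x * (1 / 2 * (c i k j x - c j k i x - c k j i x)) := by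
  have hs := fun i => he.smooth hU hx i
  have hsΓ := fun i j => mdiffAt_of_smooth (he.smooth_leviCivita hU hx (hs j) (hs i))
  -- The identities `h1` and `h2` must hold near `x`, not just at `x`, because they are
  -- differentiated in `m1` and `m2`.
  have h1 : (fun y => (inner ℝ (leviCivita I M (e j) y (e j y)) (e i y) : ℝ)) =ᶠ[𝓝 x]
      c j i j := by
    filter_upwards [hU.mem_nhds hx] with y hy
    rw [hc.inner_leviCivita he hU hy, hc.swap he hy j j i]
    have := hc.swap he hy i j j
    linarith
  have h2 : (fun y => (inner ℝ (leviCivita I M (e j) y (e i y)) (e i y) : ℝ)) =ᶠ[𝓝 x]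
      c i i j := by
    filter_upwards [hU.mem_nhds hx] with y hy
    rw [hc.inner_leviCivita he hU hy, hc.swap he hy i j i]
    have := hc.swap he hy j i i
    linarith
  have m1 := mvfderiv_inner_leviCivita (X := e i) (hsΓ j j) (mdiffAt_of_smooth (hs i))
  have m2 := mvfderiv_inner_leviCivita (X := e j) (hsΓ i j) (mdiffAt_of_smooth (hs i))
  rw [mvfderiv_congr h1] at m1
  rw [mvfderiv_congr h2, hc.mvfderiv_swap he hU hx] at m2
  have m3 : inner ℝ (leviCivita I M (e j) x (mlieBracket I (e i) (e j) x)) (e i x) =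
      ∑ k, c k i j x * (1 / 2 * (c i k j x - c j k i x - c k j i x)) := by
    rw [hc x hx i j]
    simp only [map_sum, map_smul, sum_inner, real_inner_smul_left, hc.inner_leviCivita he hU hx]
  -- The sums in `m4` and `m5` are the frame expansions of `⟨∇_{e_j} e_j, ∇_{e_i} e_i⟩` and
  -- `⟨∇_{e_i} e_j, ∇_{e_j} e_i⟩`, the corrections from metric compatibility.
  have m4 : ∑ k, (inner ℝ (leviCivita I M (e j) x (e j x)) (e k x) : ℝ) *
      inner ℝ (leviCivita I M (e i) x (e i x)) (e k x) = ∑ k, c j k j x * c i k i x := by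
    refine Finset.sum_congr rfl fun k _ => ?_
    rw [hc.inner_leviCivita he hU hx, hc.inner_leviCivita he hU hx, hc.swap he hx j j k,
      hc.swap he hx i i k]
    have := hc.swap he hx k j j
    have h0 : c k j j x = 0 := by linarith
    have := hc.swap he hx k i i
    have h0' : c k i i x = 0 := by linarith
    rw [h0, h0']
    ring
  have m5 : ∑ k, (inner ℝ (leviCivita I M (e j) x (e i x)) (e k x) : ℝ) *
      inner ℝ (leviCivita I M (e i) x (e j x)) (e k x) =
      ∑ k, 1 / 4 * ((c i j k x + c j i k x) ^ 2 - c k i j x ^ 2) := by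
    refine Finset.sum_congr rfl fun k _ => ?_
    -- With `s = c^i_{jk} + c^j_{ik}` the factors are `(c^k_{ij} - s)/2` and `(-c^k_{ij} - s)/2`,
    -- whence the difference of squares.
    rw [hc.inner_leviCivita he hU hx, hc.inner_leviCivita he hU hx, hc.swap he hx k j i]
    ring
  simp only [curvature, inner_sub_left]
  rw [he.sum_inner_mul_inner hx] at m4 m5
  linarith

end Scalar

/-- Index bookkeeping for coefficients antisymmetric in the lower indices. -/
theorem sum_antisymm_eq {ι : Type*} [Fintype ι] (c : ι → ι → ι → ℝ) (d : ι → ι → ℝ)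
    (hc : ∀ k i j, c k i j = -c k j i) :
    ∑ i, ∑ j, (d i j + d j i - ∑ k, c j k j * c i k i
        + ∑ k, 1 / 4 * ((c i j k + c j i k) ^ 2 - c k i j ^ 2)
        - ∑ k, c k i j * (1 / 2 * (c i k j - c j k i - c k j i))) =
      2 * (∑ k, ∑ j, d k j) - (∑ i, ∑ j, ∑ k, c k i k * c j i j)
        - 1 / 2 * (∑ i, ∑ j, ∑ k, c i k j * c k i j)
        - 1 / 4 * (∑ i, ∑ j, ∑ k, c i k j * c i k j) := by
  have d1 : ∑ i, ∑ j, d j i = ∑ i, ∑ j, d i j := Finset.sum_comm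
  have a1 : ∑ i, ∑ j, ∑ k, c j k j * c i k i = ∑ i, ∑ j, ∑ k, c k i k * c j i j := by
    calc ∑ i, ∑ j, ∑ k, c j k j * c i k i
        = ∑ i, ∑ k, ∑ j, c j k j * c i k i :=
          Finset.sum_congr rfl fun i _ => Finset.sum_comm
      _ = ∑ k, ∑ i, ∑ j, c j k j * c i k i := Finset.sum_comm
  -- Apart from the trace term `a1`, every quadratic sum is `±P` or `±Q` after renaming indices and
  -- using antisymmetry. The totals are `P/2 + Q/4` in `e1` and `P + Q/2` in `e2`, with difference
  -- `-P/2 - Q/4`.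
  set P := ∑ i, ∑ j, ∑ k, c i k j * c k i j with hP
  set Q := ∑ i, ∑ j, ∑ k, c i k j * c i k j with hQ
  have p1 : ∑ i, ∑ j, ∑ k, c i j k * c j i k = P :=
    Finset.sum_congr rfl fun i _ => Finset.sum_comm
  have p2 : ∑ i, ∑ j, ∑ k, c k i j * c i k j = P := by
    simp only [hP, mul_comm]
  have p3 : ∑ i, ∑ j, ∑ k, c k i j * c j k i = -P := by
    have : ∀ i j k, c k i j * c j k i = -(c k j i * c j k i) := fun i j k => by
      rw [hc k i j]; ring
    simp only [this, Finset.sum_neg_distrib]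
    rw [Finset.sum_comm]
    exact congrArg Neg.neg p2
  have q1 : ∑ i, ∑ j, ∑ k, c i j k ^ 2 = Q := by
    simp only [hQ, pow_two]
    exact Finset.sum_congr rfl fun i _ => Finset.sum_comm
  have q2 : ∑ i, ∑ j, ∑ k, c j i k ^ 2 = Q := Finset.sum_comm.trans q1
  have q3 : ∑ i, ∑ j, ∑ k, c k i j ^ 2 = Q := by
    rw [← q2]
    exact Finset.sum_congr rfl fun i _ => Finset.sum_comm
  have q4 : ∑ i, ∑ j, ∑ k, c k i j * c k j i = -Q := by
    rw [← q3]
    simp only [← Finset.sum_neg_distrib]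
    refine Finset.sum_congr rfl fun i _ => Finset.sum_congr rfl fun j _ =>
      Finset.sum_congr rfl fun k _ => ?_
    rw [hc k j i]
    ring
  have e1 : ∑ i, ∑ j, ∑ k, 1 / 4 * ((c i j k + c j i k) ^ 2 - c k i j ^ 2) =
      1 / 4 * (Q + 2 * P + Q - Q) := by
    have : ∀ i j k, 1 / 4 * ((c i j k + c j i k) ^ 2 - c k i j ^ 2) =
        1 / 4 * (c i j k ^ 2 + 2 * (c i j k * c j i k) + c j i k ^ 2 - c k i j ^ 2) :=
      fun i j k => by ring
    simp only [this, ← Finset.mul_sum, Finset.sum_add_distrib, Finset.sum_sub_distrib, p1, q1,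
      q2, q3]
  have e2 : ∑ i, ∑ j, ∑ k, c k i j * (1 / 2 * (c i k j - c j k i - c k j i)) =
      1 / 2 * (P - -P - -Q) := by
    have : ∀ i j k, c k i j * (1 / 2 * (c i k j - c j k i - c k j i)) =
        1 / 2 * (c k i j * c i k j - c k i j * c j k i - c k i j * c k j i) :=
      fun i j k => by ring
    simp only [this, ← Finset.mul_sum, Finset.sum_sub_distrib, p2, p3, q4]
  simp only [Finset.sum_add_distrib, Finset.sum_sub_distrib]
  rw [d1, a1, e1, e2]
  ring

end RiemannianScalar

theorem theorem2p3 {n : ℕ} {M : Type*} [TopologicalSpace M]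
    [ChartedSpace (EuclideanSpace ℝ (Fin n)) M] [IsManifold (𝓡 n) ∞ M]
    [RiemannianBundle (fun x : M => TangentSpace (𝓡 n) x)]
    [IsContMDiffRiemannianBundle (𝓡 n) ∞ (EuclideanSpace ℝ (Fin n))
      (fun x : M => TangentSpace (𝓡 n) x)]
    (U : Set M) (hU : IsOpen U)
    (e : Fin n → Π x : M, TangentSpace (𝓡 n) x)
    (he : RiemannianScalar.IsOrthonormalFrameOn (𝓡 n) e U)
    (c : Fin n → Fin n → Fin n → M → ℝ)
    (hc : RiemannianScalar.IsStructureFunctionsOn (𝓡 n) e c U)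
    (x : M) (hx : x ∈ U) :
    RiemannianScalar.scalarCurvature (𝓡 n) x =
      2 * (∑ k, ∑ j, mvfderiv (𝓡 n) (c j k j) x (e k x))
        - (∑ i, ∑ j, ∑ k, c k i k x * c j i j x)
        - 1 / 2 * (∑ i, ∑ j, ∑ k, c i k j x * c k i j x)
        - 1 / 4 * (∑ i, ∑ j, ∑ k, c i k j x * c i k j x) := by
  rw [he.scalarCurvature_eq hU hx]
  simp only [hc.inner_curvature he hU hx]
  exact RiemannianScalar.sum_antisymm_eq (fun k i j => c k i j x)
    (fun i j => mvfderiv (𝓡 n) (c j i j) x (e i x)) (fun k i j => hc.swap he hx k i j)
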